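/- Let $X_1, X_2, \dots$ be IID from a probability measure $P_0$ on a measurable space $\mathcal{X}$, let $\mathbb{P}_n$ be the empirical distribution of $X_1,\dots,X_n$, and write $Pf := \int f\,dP$, $\mathbb{P}_n f := n^{-1}\sum_{i=1}^n f(X_i)$ and $\mathbb{G}_n f := n^{1/2}(\mathbb{P}_n - P_0) f$. Let $T(\eta, P)$ be a real-valued functional of a nuisance parameter $\eta$ and a measure $P$, let $\eta_0$ be the true nuisance parameter and $\eta_n$ an estimator of it, let $\phi_0 : \mathcal{X} \to \mathbb{R}$ be a function with $P_0\phi_0 = 0$ and $P_0\phi_0^2 < \infty$ (the influence function), and let $\phi_n : \mathcal{X} \to \mathbb{R}$ be random functions (estimators of $\phi_0$). Random quantities need not be measurable: $P_0^*$ denotes outer probability, $Y_n = o_{P_0^*}(r_n)$ means $P_0^*(|Y_n| \geq \varepsilon r_n) \to 0$ for every $\varepsilon > 0$, and $\rightsquigarrow$ denotes weak convergence in the sense of outer expectations, that is, $G_n \rightsquigarrow G$ if $E^* h(G_n) \to E h(G)$ for all bounded continuous $h$. Put $R_n := T(\eta_n, \mathbb{P}_n) - T(\eta_0, P_0) - (\mathbb{P}_n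 - P_0)\phi_n$. Assume: (A1) there is a $P_0$-Donsker class $\mathcal{F}$ of measurable real-valued functions on $\mathcal{X}$ such that $\phi_0 \in \mathcal{F}$ and $\phi_n \in \mathcal{F}$ with probability tending to one, i.e. $P_0^*(\phi_n \notin \mathcal{F}) \to 0$; here $P_0$-Donsker means that $\mathcal{F} \subset L_2(P_0)$, that the paths $f \mapsto \mathbb{G}_n f$ are almost surely bounded on $\mathcal{F}$ for every $n$, and that $\mathbb{G}_n \rightsquigarrow \mathbb{G}_0$ in the space $\ell^\infty(\mathcal{F})$ of bounded functions on $\mathcal{F}$ with the supremum norm, where $\mathbb{G}_0$ is a tight, Borel measurable $P_0$-Brownian bridge process, i.e. a mean-zero Gaussian process with covariance function $P_0(fg) - P_0 f\, P_0 g$; (A2) $\|\phi_n - \phi_0\|_{L_2(P_0)} = o_{P_0^*}(1)$; (A3) $R_n = o_{P_0^*}(n^{-1/2})$. Then $T(\eta_n, \mathbb{P}_n) = T(\eta_0, P_0) + \mathbb{P}_n\phi_0 + o_{P_0^*}(n^{-1/2})$. Moreover $n^{1/2}\left[T(\eta_n, \mathbb{P}_n) - T(\eta_0, P_0)\right] \rightsquigarrow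 \mathbb{G}_0\phi_0$, and $\mathbb{G}_0\phi_0$ follows the normal distribution $N(0, P_0\phi_0^2)$. -/

import Mathlib

open MeasureTheory ProbabilityTheory Filter Topology
open scoped ENNReal NNReal BoundedContinuousFunction

noncomputable section

/-- The Banach space `ℓ^∞(F)` of bounded real-valued functions on the set of functions `F`, with
the supremum norm. -/
abbrev EllInfty {𝒳 : Type*} (F : Set (𝒳 → ℝ)) : Type _ := lp (fun _ : F => ℝ) ∞

/-- `ℓ^∞(F)` carries the Borel σ-algebra of its norm. -/
instance EllInfty.instMeasurableSpace {𝒳 : Type*} (F : Set (𝒳 → ℝ)) :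
    MeasurableSpace (EllInfty F) := borel _

instance EllInfty.instBorelSpace {𝒳 : Type*} (F : Set (𝒳 → ℝ)) : BorelSpace (EllInfty F) := ⟨rfl⟩

open Classical in
/-- A bounded function `z : F → ℝ` as an element of `ℓ^∞(F)` (the value `0` at an unbounded `z`
is a convention; it is only used on an event of probability zero). -/
def toEllInfty {𝒳 : Type*} (F : Set (𝒳 → ℝ)) (z : F → ℝ) : EllInfty F :=
  if hz : Memℓp z ∞ then ⟨z, hz⟩ else 0

/-- The outer expectation `E^* Z`: the infimum of `E U` over measurable `U` with `U ≥ Z` almost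
surely and `E U` finite. (It is applied to bounded `Z` and probability measures only, so the set
is nonempty and bounded below.) -/
def outerExpectation {Ω : Type*} [MeasurableSpace Ω] (μ : Measure Ω) (Z : Ω → ℝ) : ℝ :=
  sInf {e : ℝ | ∃ U : Ω → ℝ, Measurable U ∧ Integrable U μ ∧ (∀ᵐ ω ∂μ, Z ω ≤ U ω) ∧
    e = ∫ ω, U ω ∂μ}

/-- Weak convergence `G_n ⇝ G` of possibly non-measurable maps `G_n : Ω → D` to a limit with Borel
law `ν`: `E^* h(G_n) → E h(G)` for all bounded continuous `h : D → ℝ`. -/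
def WeaklyConverges {Ω D : Type*} [MeasurableSpace Ω] [TopologicalSpace D] [MeasurableSpace D]
    (μ : Measure Ω) (G : ℕ → Ω → D) (ν : Measure D) : Prop :=
  ∀ h : D →ᵇ ℝ, Tendsto (fun n => outerExpectation μ (fun ω => h (G n ω))) atTop
    (𝓝 (∫ z, h z ∂ν))

/-- `Y_n = o_{P^*}(n^{-1/2})`: for every `ε > 0` the outer probability of `√n |Y_n| ≥ ε` tends
to zero. (A measure, evaluated at an arbitrary set, is the outer measure of that set.) -/
def IsLittleOPRootN {Ω : Type*} [MeasurableSpace Ω] (μ : Measure Ω) (Y : ℕ → Ω → ℝ) : Prop :=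
  ∀ ε : ℝ, 0 < ε → Tendsto (fun n : ℕ => μ {ω | ε ≤ √(n : ℝ) * |Y n ω|}) atTop (𝓝 0)

/-- The empirical distribution `ℙ_n` of `X_1, …, X_n` (here `X 0, …, X (n - 1)`). -/
def empiricalMeasure {Ω 𝒳 : Type*} [MeasurableSpace 𝒳] (X : ℕ → Ω → 𝒳) (n : ℕ) (ω : Ω) :
    Measure 𝒳 :=
  (n : ℝ≥0∞)⁻¹ • ∑ i ∈ Finset.range n, Measure.dirac (X i ω)

/-- `ℙ_n f = n⁻¹ ∑ f(X_i)`. -/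
def empiricalMean {Ω 𝒳 : Type*} (X : ℕ → Ω → 𝒳) (n : ℕ) (ω : Ω) (f : 𝒳 → ℝ) : ℝ :=
  (n : ℝ)⁻¹ * ∑ i ∈ Finset.range n, f (X i ω)

/-- The empirical process `𝔾_n f = n^{1/2} (ℙ_n - P) f`. -/
def empiricalProcess {Ω 𝒳 : Type*} [MeasurableSpace 𝒳] (P : Measure 𝒳) (X : ℕ → Ω → 𝒳)
    (n : ℕ) (ω : Ω) (f : 𝒳 → ℝ) : ℝ :=
  √(n : ℝ) * (empiricalMean X n ω f - ∫ x, f x ∂P)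

/-- `ν` is the law on `ℓ^∞(F)` of a (tight, Borel measurable) `P`-Brownian bridge process:
a centred Gaussian process with covariance function `P(fg) - Pf Pg`. -/
structure IsBrownianBridgeLaw {𝒳 : Type*} [MeasurableSpace 𝒳] (P : Measure 𝒳)
    (F : Set (𝒳 → ℝ)) (ν : Measure (EllInfty F)) : Prop where
  isProbabilityMeasure : IsProbabilityMeasure ν
  tight : IsTightMeasureSet {ν}
  gaussian : IsGaussianProcess (fun (f : F) (z : EllInfty F) => z f) ν
  mean_zero : ∀ f : F, ∫ z, z f ∂ν = 0
  covariance_eq : ∀ f g : F, cov[fun z : EllInfty F => z f, fun z : EllInfty F => z g; ν] =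
    ∫ x, (f : 𝒳 → ℝ) x * (g : 𝒳 → ℝ) x ∂P - (∫ x, (f : 𝒳 → ℝ) x ∂P) * ∫ x, (g : 𝒳 → ℝ) x ∂P

/-- `F` is a `P`-Donsker class of measurable functions, with limit process of law `ν`:
`𝔾_n ⇝ 𝔾_0` in `ℓ^∞(F)`, where `𝔾_0` is the `P`-Brownian bridge. Square integrability of the
members of `F` is what gives the covariance function a meaning, and almost sure boundedness of
the sample paths is what makes `𝔾_n` a map into `ℓ^∞(F)`. -/
structure IsDonsker {Ω 𝒳 : Type*} [MeasurableSpace Ω] [MeasurableSpace 𝒳] (μ : Measure Ω)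
    (P : Measure 𝒳) (X : ℕ → Ω → 𝒳) (F : Set (𝒳 → ℝ)) (ν : Measure (EllInfty F)) : Prop where
  measurable : ∀ f ∈ F, Measurable f
  memLp_two : ∀ f ∈ F, MemLp f 2 P
  bounded : ∀ n : ℕ, ∀ᵐ ω ∂μ, Memℓp (fun f : F => empiricalProcess P X n ω f) ∞
  brownianBridge : IsBrownianBridgeLaw P F ν
  weaklyConverges : WeaklyConverges μ
    (fun n ω => toEllInfty F (fun f : F => empiricalProcess P X n ω f)) ν

end

/-!
Weak convergence of `𝔾_n` in `ℓ^∞(F)` to a tight law forces asymptotic equicontinuity. Tightness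
and Arzelà–Ascoli split `F` into finitely many cells on which the paths of the limit barely vary,
and the variance of an increment `𝔾_0 f - 𝔾_0 g` is at most `‖f - g‖²` in `L²(P)`, so that `𝔾_0 f`
is uniformly close to `𝔾_0 φ₀` over all `f` near `φ₀`, off an event of small probability; the
portmanteau theorem carries this over to `𝔾_n`. Hence `𝔾_n φ_n - 𝔾_n φ₀` tends to `0` in outer
probability, and by the bound on the remainder so does `√n (T(η_n, ℙ_n) - T(η_0, P_0)) - 𝔾_n φ₀`.
Since `𝔾_n φ₀ ⇝ 𝔾_0 φ₀` by continuity of evaluation at `φ₀`, Slutsky's lemma for outer expectations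
gives the limit.
-/

section OuterExpectation

variable {Ω : Type*} [MeasurableSpace Ω] {μ : Measure Ω} {Z W : Ω → ℝ}

theorem outerExpectation_congr_ae (h : Z =ᵐ[μ] W) :
    outerExpectation μ Z = outerExpectation μ W := by
  have hle (U : Ω → ℝ) : (∀ᵐ ω ∂μ, Z ω ≤ U ω) ↔ ∀ᵐ ω ∂μ, W ω ≤ U ω :=
    eventually_congr (h.mono fun ω hω => by rw [hω])
  simp only [outerExpectation, hle]

variable [IsFiniteMeasure μ]

theorem le_outerExpectation {C a : ℝ} (hZ : ∀ ω, Z ω ≤ C)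
    (h : ∀ U : Ω → ℝ, Measurable U → Integrable U μ → Z ≤ᵐ[μ] U → a ≤ ∫ ω, U ω ∂μ) :
    a ≤ outerExpectation μ Z := by
  refine le_csInf ⟨_, fun _ => C, measurable_const, integrable_const C, ae_of_all μ hZ, rfl⟩ ?_
  rintro _ ⟨U, hU, hUi, hZU, rfl⟩
  exact h U hU hUi hZU

theorem outerExpectation_le_integral {U : Ω → ℝ} {c : ℝ} (hZ : ∀ ω, c ≤ Z ω) (hU : Measurable U)
    (hUi : Integrable U μ) (hZU : Z ≤ᵐ[μ] U) : outerExpectation μ Z ≤ ∫ ω, U ω ∂μ := by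
  refine csInf_le ⟨∫ _, c ∂μ, ?_⟩ ⟨U, hU, hUi, hZU, rfl⟩
  rintro _ ⟨V, -, hVi, hZV, rfl⟩
  exact integral_mono_ae (integrable_const c) hVi (hZV.mono fun ω h => (hZ ω).trans h)

theorem outerExpectation_le_add_integral {V : Ω → ℝ} {c C : ℝ} (hZ : ∀ ω, c ≤ Z ω)
    (hW : ∀ ω, W ω ≤ C) (hV : Measurable V) (hVi : Integrable V μ)
    (h : ∀ ω, Z ω ≤ W ω + V ω) :
    outerExpectation μ Z ≤ outerExpectation μ W + ∫ ω, V ω ∂μ := by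
  rw [← sub_le_iff_le_add]
  refine le_outerExpectation hW fun U hU hUi hWU => ?_
  rw [sub_le_iff_le_add, ← integral_add hUi hVi]
  exact outerExpectation_le_integral hZ (hU.add hV) (hUi.add hVi)
    (hWU.mono fun ω hω => (h ω).trans (add_le_add_left hω _))

theorem mul_measureReal_ge_le_outerExpectation {C : ℝ} (hZ₀ : ∀ ω, 0 ≤ Z ω) (hZ : ∀ ω, Z ω ≤ C)
    {ε : ℝ} (hε : 0 ≤ ε) : ε * μ.real {ω | ε ≤ Z ω} ≤ outerExpectation μ Z := by
  refine le_outerExpectation hZ fun U _ hUi hZU => ?_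
  have hU₀ : 0 ≤ᵐ[μ] U := hZU.mono fun ω h => (hZ₀ ω).trans h
  have hlevel : μ.real {ω | ε ≤ Z ω} ≤ μ.real {ω | ε ≤ U ω} :=
    ENNReal.toReal_mono (measure_ne_top _ _)
      (measure_mono_ae (hZU.mono fun ω h hε => le_trans hε h))
  exact (mul_le_mul_of_nonneg_left hlevel hε).trans (mul_meas_ge_le_integral_of_nonneg hU₀ hUi ε)

theorem outerExpectation_le_add_of_le_off {A : Set Ω} {C ε : ℝ} (hZ : ∀ ω, |Z ω| ≤ C)
    (hW : ∀ ω, |W ω| ≤ C) (hε : 0 ≤ ε) (h : ∀ ω ∉ A, Z ω ≤ W ω + ε) :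
    outerExpectation μ Z ≤ outerExpectation μ W + (ε * μ.real .univ + 2 * C * μ.real A) := by
  have hA := measurableSet_toMeasurable μ A
  let V : Ω → ℝ := fun ω => ε + (toMeasurable μ A).indicator (fun _ => 2 * C) ω
  have hind : Integrable ((toMeasurable μ A).indicator fun _ => 2 * C) μ :=
    (integrable_const _).indicator hA
  have hV : ∫ ω, V ω ∂μ = ε * μ.real .univ + 2 * C * μ.real A := by
    rw [integral_add (integrable_const _) hind, integral_indicator_const _ hA, integral_const,
      measureReal_def μ (toMeasurable μ A), measure_toMeasurable, smul_eq_mul, smul_eq_mul,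
      mul_comm ε, mul_comm (2 * C), measureReal_def μ A]
  rw [← hV]
  refine outerExpectation_le_add_integral (fun ω => (abs_le.1 (hZ ω)).1)
    (fun ω => (abs_le.1 (hW ω)).2) (measurable_const.add (measurable_const.indicator hA))
    ((integrable_const _).add hind) fun ω => ?_
  have hZω := abs_le.1 (hZ ω)
  have hWω := abs_le.1 (hW ω)
  by_cases hωA : ω ∈ toMeasurable μ A
  · simp only [V, Set.indicator_of_mem hωA]
    linarith
  · simp only [V, Set.indicator_of_notMem hωA, add_zero]
    exact h ω fun hω => hωA (subset_toMeasurable μ A hω)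

theorem abs_outerExpectation_sub_le {A : Set Ω} {C ε : ℝ} (hZ : ∀ ω, |Z ω| ≤ C)
    (hW : ∀ ω, |W ω| ≤ C) (hε : 0 ≤ ε) (h : ∀ ω ∉ A, |Z ω - W ω| ≤ ε) :
    |outerExpectation μ Z - outerExpectation μ W| ≤ ε * μ.real .univ + 2 * C * μ.real A := by
  rw [abs_sub_le_iff, sub_le_iff_le_add', sub_le_iff_le_add']
  exact ⟨outerExpectation_le_add_of_le_off hZ hW hε fun ω hω => by
      linarith [(abs_sub_le_iff.1 (h ω hω)).1],
    outerExpectation_le_add_of_le_off hW hZ hε fun ω hω => by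
      linarith [(abs_sub_le_iff.1 (h ω hω)).2]⟩

end OuterExpectation

section AsympEquivInProb

/-- Asymptotic equivalence in outer probability: `dist (Y_n, Z_n) = o_{P^*}(1)`. The maps need not
be measurable; `μ` is evaluated at arbitrary sets as an outer measure. This differs from
`TendstoInMeasure` only in that both maps vary with `n`. -/
def AsympEquivInProb {Ω D : Type*} [MeasurableSpace Ω] [PseudoMetricSpace D] (μ : Measure Ω)
    (Y Z : ℕ → Ω → D) : Prop :=
  ∀ ε : ℝ, 0 < ε → Tendsto (fun n => μ {ω | ε ≤ dist (Y n ω) (Z n ω)}) atTop (𝓝 0)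

variable {Ω D : Type*} [MeasurableSpace Ω] [PseudoMetricSpace D] {μ : Measure Ω}

theorem AsympEquivInProb.trans {W Y Z : ℕ → Ω → D} (hWY : AsympEquivInProb μ W Y)
    (hYZ : AsympEquivInProb μ Y Z) : AsympEquivInProb μ W Z := by
  intro ε hε
  have hsum := (hWY _ (half_pos hε)).add (hYZ _ (half_pos hε))
  rw [add_zero] at hsum
  refine tendsto_of_tendsto_of_tendsto_of_le_of_le tendsto_const_nhds hsum (fun _ => zero_le)
    fun n => (measure_mono fun ω hω => ?_).trans (measure_union_le _ _)
  by_contra hlt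
  simp only [Set.mem_union, Set.mem_ofPred_eq, not_or, not_le] at hlt hω
  linarith [dist_triangle (W n ω) (Y n ω) (Z n ω)]

theorem isLittleOPRootN_sub_iff {Y Z : ℕ → Ω → ℝ} :
    IsLittleOPRootN μ (fun n ω => Y n ω - Z n ω) ↔
      AsympEquivInProb μ (fun n ω => √(n : ℝ) * Y n ω) (fun n ω => √(n : ℝ) * Z n ω) := by
  simp only [IsLittleOPRootN, AsympEquivInProb, Real.dist_eq, ← mul_sub, abs_mul,
    abs_of_nonneg (Real.sqrt_nonneg _)]

theorem AsympEquivInProb.tendsto_outerExpectation_sub [IsFiniteMeasure μ] {Y Z : ℕ → Ω → ℝ}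
    {C : ℝ} (hYZ : AsympEquivInProb μ Y Z) (hY : ∀ n ω, |Y n ω| ≤ C) (hZ : ∀ n ω, |Z n ω| ≤ C) :
    Tendsto (fun n => outerExpectation μ (Y n) - outerExpectation μ (Z n)) atTop (𝓝 0) := by
  rw [Metric.tendsto_nhds]
  intro ε hε
  set m := μ.real .univ
  have : 0 ≤ m := measureReal_nonneg
  have hδ : 0 < ε / (m + 1) := by positivity
  have hδm : ε / (m + 1) * m < ε := by
    rw [div_mul_eq_mul_div, div_lt_iff₀ (by positivity)]
    linarith
  have hbound : Tendsto (fun n => ε / (m + 1) * m +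
      2 * C * μ.real {ω | ε / (m + 1) ≤ dist (Y n ω) (Z n ω)}) atTop (𝓝 (ε / (m + 1) * m)) := by
    simpa only [measureReal_def, mul_zero, add_zero] using
      (((ENNReal.tendsto_toReal_zero_iff fun _ => measure_ne_top _ _).2
        (hYZ _ hδ)).const_mul (2 * C)).const_add (ε / (m + 1) * m)
  filter_upwards [hbound.eventually_lt_const hδm] with n hn
  rw [dist_zero_right, Real.norm_eq_abs]
  exact (abs_outerExpectation_sub_le (hY n) (hZ n) hδ.le fun ω hω => (not_le.1 hω).le).trans_lt hn

end AsympEquivInProb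

namespace WeaklyConverges

variable {Ω D : Type*} [MeasurableSpace Ω] {μ : Measure Ω} [MeasurableSpace D]

theorem congr_ae [TopologicalSpace D] {G G' : ℕ → Ω → D} {ν : Measure D}
    (hG : WeaklyConverges μ G ν) (h : ∀ n, G n =ᵐ[μ] G' n) : WeaklyConverges μ G' ν :=
  fun f => (hG f).congr fun n => outerExpectation_congr_ae ((h n).fun_comp f)

theorem map [TopologicalSpace D] [OpensMeasurableSpace D] {E : Type*} [TopologicalSpace E]
    [MeasurableSpace E] [BorelSpace E]
    {G : ℕ → Ω → D} {ν : Measure D} (hG : WeaklyConverges μ G ν) {g : D → E} (hg : Continuous g) :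
    WeaklyConverges μ (fun n ω => g (G n ω)) (ν.map g) := by
  intro h
  rw [integral_map hg.measurable.aemeasurable h.continuous.measurable.aestronglyMeasurable]
  exact hG (h.compContinuous ⟨g, hg⟩)

variable [IsFiniteMeasure μ] {G : ℕ → Ω → D} {ν : Measure D} [IsFiniteMeasure ν]

theorem eventually_measure_lt_of_isClosed [TopologicalSpace D] [HasOuterApproxClosed D]
    [OpensMeasurableSpace D] (hG : WeaklyConverges μ G ν) {B : Set D} (hB : IsClosed B) {c : ℝ≥0∞}
    (hc : ν B < c) : ∀ᶠ n in atTop, μ {ω | G n ω ∈ B} < c := by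
  obtain ⟨k, hk⟩ :=
    ((HasOuterApproxClosed.tendsto_lintegral_apprSeq hB ν).eventually_lt_const hc).exists
  have hle_one (z : D) : (hB.apprSeq k z : ℝ) ≤ 1 :=
    mod_cast HasOuterApproxClosed.apprSeq_apply_le_one hB k z
  let h : D →ᵇ ℝ := BoundedContinuousFunction.ofNormedAddCommGroup (fun z => (hB.apprSeq k z : ℝ))
    (NNReal.continuous_coe.comp (hB.apprSeq k).continuous) 1
    fun z => (Real.norm_of_nonneg (NNReal.coe_nonneg _)).trans_le (hle_one z)
  have hint : ENNReal.ofReal (∫ z, h z ∂ν) = ∫⁻ z, hB.apprSeq k z ∂ν :=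
    (congrArg ENNReal.ofReal ((hB.apprSeq k).toReal_lintegral_coe_eq_integral ν).symm).trans
      (ENNReal.ofReal_toReal hk.ne_top)
  have hmarkov (n : ℕ) :
      μ {ω | G n ω ∈ B} ≤ ENNReal.ofReal (outerExpectation μ fun ω => h (G n ω)) := by
    have := mul_measureReal_ge_le_outerExpectation (μ := μ) (Z := fun ω => h (G n ω))
      (fun ω => NNReal.coe_nonneg _) (fun ω => hle_one _) zero_le_one
    rw [one_mul] at this
    refine (measure_mono fun ω hω => ?_).trans
      ((ofReal_measureReal (measure_ne_top _ _)).symm.trans_le (ENNReal.ofReal_le_ofReal this))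
    exact (congrArg NNReal.toReal (HasOuterApproxClosed.apprSeq_apply_eq_one hB k hω)).ge
  have hlim := ENNReal.tendsto_ofReal (hG h)
  rw [hint] at hlim
  filter_upwards [hlim.eventually_lt_const hk] with n hn
  exact (hmarkov n).trans_lt hn

end WeaklyConverges

section Slutsky

theorem exists_measure_closure_oscillation_lt {D E : Type*} [PseudoMetricSpace D]
    [MeasurableSpace D] [OpensMeasurableSpace D] [PseudoMetricSpace E] (ν : Measure D)
    [IsFiniteMeasure ν] {h : D → E} (hh : Continuous h) {ε : ℝ} (hε : 0 < ε) {c : ℝ≥0∞}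
    (hc : 0 < c) :
    ∃ r : ℝ, 0 < r ∧ ν (closure {x | ∃ y, dist y x < r ∧ ε ≤ dist (h y) (h x)}) < c := by
  set B : ℝ → Set D := fun r => closure {x | ∃ y, dist y x < r ∧ ε ≤ dist (h y) (h x)}
  have hinter : ⋂ r > 0, B r = ∅ := by
    refine Set.eq_empty_of_forall_notMem fun x hx => ?_
    obtain ⟨ρ, hρ, hcont⟩ := Metric.continuousAt_iff.1 hh.continuousAt (ε / 2) (half_pos hε)
    obtain ⟨x', ⟨y, hyx', hy⟩, hxx'⟩ :=
      Metric.mem_closure_iff.1 (Set.mem_iInter₂.1 hx (ρ / 2) (half_pos hρ)) (ρ / 2) (half_pos hρ)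
    rw [dist_comm] at hxx'
    have hx'_near := hcont (show dist x' x < ρ by linarith)
    have hy_near := hcont (show dist y x < ρ by linarith [dist_triangle y x' x])
    linarith [dist_triangle_right (h y) (h x') (h x)]
  have hlim : Tendsto (ν ∘ B) (𝓝[>] 0) (𝓝 (ν (⋂ r > 0, B r))) :=
    tendsto_measure_biInter_gt (fun r _ => isClosed_closure.measurableSet.nullMeasurableSet)
      (fun r s _ hrs => closure_mono fun x ⟨y, hyx, hy⟩ => ⟨y, hyx.trans_le hrs, hy⟩)
      ⟨1, one_pos, measure_ne_top _ _⟩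
  rw [hinter, measure_empty] at hlim
  obtain ⟨r, hrc, hr⟩ := ((hlim.eventually_lt_const hc).and self_mem_nhdsWithin).exists
  exact ⟨r, hr, hrc⟩

variable {Ω D : Type*} [MeasurableSpace Ω] {μ : Measure Ω} [IsFiniteMeasure μ]
  [PseudoMetricSpace D] [MeasurableSpace D] [OpensMeasurableSpace D] {Y G : ℕ → Ω → D}
  {ν : Measure D} [IsFiniteMeasure ν]

-- `h` need not be uniformly continuous: the limit law charges little the points near which `h`
-- oscillates at a small scale, so by the portmanteau bound `G_n` rarely falls among them.
theorem AsympEquivInProb.comp_continuous {E : Type*} [PseudoMetricSpace E]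
    (hYG : AsympEquivInProb μ Y G) (hG : WeaklyConverges μ G ν) {h : D → E} (hh : Continuous h) :
    AsympEquivInProb μ (fun n ω => h (Y n ω)) (fun n ω => h (G n ω)) := by
  intro ε hε
  rw [ENNReal.tendsto_nhds_zero]
  intro c hc
  obtain ⟨r, hr, hνr⟩ :=
    exists_measure_closure_oscillation_lt ν hh hε (ENNReal.half_pos hc.ne')
  filter_upwards [hG.eventually_measure_lt_of_isClosed isClosed_closure hνr,
    (hYG r hr).eventually_lt_const (ENNReal.half_pos hc.ne')] with n hosc hdist
  set B : Set D := closure {x | ∃ y, dist y x < r ∧ ε ≤ dist (h y) (h x)}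
  calc μ {ω | ε ≤ dist (h (Y n ω)) (h (G n ω))}
      ≤ μ ({ω | G n ω ∈ B} ∪ {ω | r ≤ dist (Y n ω) (G n ω)}) := by
        refine measure_mono fun ω hω => ?_
        rcases lt_or_ge (dist (Y n ω) (G n ω)) r with hlt | hge
        · exact Or.inl (subset_closure ⟨Y n ω, hlt, hω⟩)
        · exact Or.inr hge
    _ ≤ c / 2 + c / 2 := (measure_union_le _ _).trans (add_le_add hosc.le hdist.le)
    _ = c := ENNReal.add_halves c

theorem WeaklyConverges.of_asympEquivInProb (hG : WeaklyConverges μ G ν)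
    (hYG : AsympEquivInProb μ Y G) : WeaklyConverges μ Y ν := by
  intro h
  have hdiff := (hYG.comp_continuous hG h.continuous).tendsto_outerExpectation_sub
    (fun n ω => h.norm_coe_le_norm (Y n ω)) (fun n ω => h.norm_coe_le_norm (G n ω))
  simpa using hdiff.add (hG h)

end Slutsky

section TightLaws

variable {ι E : Type*} [NormedAddCommGroup E]

theorem dist_lp_apply_le (z w : lp (fun _ : ι => E) ∞) (i : ι) : dist (z i) (w i) ≤ dist z w := by
  rw [dist_eq_norm, dist_eq_norm]
  exact lp.norm_apply_le_norm ENNReal.top_ne_zero (z - w) i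

-- Arzelà–Ascoli: on a compact set the coordinate evaluations are bounded and `1`-Lipschitz.
theorem exists_finset_forall_dist_apply_lt [ProperSpace E] {K : Set (lp (fun _ : ι => E) ∞)}
    (hK : IsCompact K) {ε : ℝ} (hε : 0 < ε) :
    ∃ t : Finset ι, ∀ i, ∃ j ∈ t, ∀ z ∈ K, dist (z i) (z j) < ε := by
  have : CompactSpace K := isCompact_iff_compactSpace.1 hK
  have hlip (i : ι) : LipschitzWith 1 fun z : K => z.1 i :=
    LipschitzWith.of_dist_le_mul fun z w => by
      rw [NNReal.coe_one, one_mul]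
      exact dist_lp_apply_le z.1 w.1 i
  let eval : ι → K →ᵇ E := fun i =>
    BoundedContinuousFunction.mkOfCompact ⟨fun z : K => z.1 i, (hlip i).continuous⟩
  obtain ⟨R, hR⟩ := hK.isBounded.exists_norm_le
  have hcpt : IsCompact (closure (Set.range eval)) := by
    refine BoundedContinuousFunction.arzela_ascoli _ (isCompact_closedBall (0 : E) R) _ ?_ ?_
    · rintro _ z ⟨i, rfl⟩
      exact mem_closedBall_zero_iff.2
        ((lp.norm_apply_le_norm ENNReal.top_ne_zero z.1 i).trans (hR z z.2))
    · refine (LipschitzWith.uniformEquicontinuous _ 1 ?_).equicontinuous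
      rintro ⟨_, i, rfl⟩
      exact hlip i
  obtain ⟨t, ht⟩ := hcpt.elim_finite_subcover (fun j => Metric.ball (eval j) ε)
    (fun _ => Metric.isOpen_ball) fun u hu => by
      obtain ⟨_, ⟨j, rfl⟩, hj⟩ := Metric.mem_closure_iff.1 hu ε hε
      exact Set.mem_iUnion.2 ⟨j, hj⟩
  refine ⟨t, fun i => ?_⟩
  obtain ⟨j, hj, hij⟩ := Set.mem_iUnion₂.1 (ht (subset_closure ⟨i, rfl⟩))
  exact ⟨j, hj, fun z hz =>
    (BoundedContinuousFunction.dist_coe_le_dist (⟨z, hz⟩ : K)).trans_lt hij⟩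

variable [MeasurableSpace (lp (fun _ : ι => E) ∞)]

theorem exists_mem_measure_exists_le_dist_apply_le [ProperSpace E]
    {ν : Measure (lp (fun _ : ι => E) ∞)} (hν : IsTightMeasureSet {ν}) {l : Filter ι} {j : ι}
    (hl : TendstoInMeasure ν (fun i z => z i) l (fun z => z j)) {ε : ℝ} (hε : 0 < ε) {c : ℝ≥0∞}
    (hc : 0 < c) : ∃ U ∈ l, ν {z | ∃ i ∈ U, ε ≤ dist (z i) (z j)} ≤ c := by
  have hc₂ := ENNReal.half_pos hc.ne'
  obtain ⟨K, hK, hνK⟩ :=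
    isTightMeasureSet_iff_exists_isCompact_measure_compl_le.1 hν (c / 2) hc₂
  obtain ⟨t, ht⟩ := exists_finset_forall_dist_apply_lt hK (ε := ε / 4) (by positivity)
  set U : Set ι := {i | ν {z | ε / 2 ≤ dist (z i) (z j)} ≤ c / 2 / t.card}
  have hU : U ∈ l := ENNReal.tendsto_nhds_zero.1 (tendstoInMeasure_iff_dist.1 hl _ (half_pos hε))
    _ (ENNReal.div_pos hc₂.ne' (ENNReal.natCast_ne_top _))
  let cell : ι → Set ι := fun k => {i ∈ U | ∀ z ∈ K, dist (z i) (z k) < ε / 4}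
  have hcell (k : ι) :
      ν {z | z ∈ K ∧ ∃ i ∈ cell k, ε ≤ dist (z i) (z j)} ≤ c / 2 / t.card := by
    obtain hempty | ⟨i₀, hi₀U, hi₀⟩ := (cell k).eq_empty_or_nonempty
    · simp [hempty]
    · refine (measure_mono ?_).trans hi₀U
      rintro z ⟨hz, i, ⟨-, hi⟩, hzi⟩
      change ε / 2 ≤ dist (z i₀) (z j)
      linarith [hi z hz, hi₀ z hz, dist_triangle_right (z i) (z i₀) (z k),
        dist_triangle (z i) (z i₀) (z j)]
  refine ⟨U, hU, ?_⟩
  calc ν {z | ∃ i ∈ U, ε ≤ dist (z i) (z j)}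
      ≤ ν (Kᶜ ∪ ⋃ k ∈ t, {z | z ∈ K ∧ ∃ i ∈ cell k, ε ≤ dist (z i) (z j)}) := by
        refine measure_mono fun z ⟨i, hiU, hi⟩ => ?_
        by_cases hz : z ∈ K
        · obtain ⟨k, hk, hik⟩ := ht i
          exact Or.inr (Set.mem_iUnion₂.2 ⟨k, hk, hz, i, ⟨hiU, hik⟩, hi⟩)
        · exact Or.inl hz
    _ ≤ ν Kᶜ + ∑ k ∈ t, ν {z | z ∈ K ∧ ∃ i ∈ cell k, ε ≤ dist (z i) (z j)} :=
        (measure_union_le _ _).trans (by gcongr; exact measure_biUnion_finset_le _ _)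
    _ ≤ c / 2 + t.card • (c / 2 / t.card) :=
        add_le_add (hνK ν rfl) (Finset.sum_le_card_nsmul _ _ _ fun k _ => hcell k)
    _ ≤ c / 2 + c / 2 := by
        rw [nsmul_eq_mul]
        gcongr
        exact ENNReal.mul_div_le
    _ = c := ENNReal.add_halves c

theorem WeaklyConverges.eventually_measure_exists_le_dist_apply_lt [ProperSpace E]
    [OpensMeasurableSpace (lp (fun _ : ι => E) ∞)] {Ω : Type*} [MeasurableSpace Ω] {μ : Measure Ω}
    [IsFiniteMeasure μ] {G : ℕ → Ω → lp (fun _ : ι => E) ∞} {ν : Measure (lp (fun _ : ι => E) ∞)}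
    [IsFiniteMeasure ν] (hG : WeaklyConverges μ G ν) (hν : IsTightMeasureSet {ν}) {l : Filter ι}
    {j : ι} (hl : TendstoInMeasure ν (fun i z => z i) l (fun z => z j)) {ε : ℝ} (hε : 0 < ε)
    {c : ℝ≥0∞} (hc : 0 < c) :
    ∃ U ∈ l, ∀ᶠ n in atTop, μ {ω | ∃ i ∈ U, ε ≤ dist (G n ω i) (G n ω j)} < c := by
  obtain ⟨c', hc', hc'c⟩ := exists_between hc
  obtain ⟨U, hU, hνU⟩ := exists_mem_measure_exists_le_dist_apply_le hν hl (half_pos hε) hc'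
  set B : Set (lp (fun _ : ι => E) ∞) := {z | ∃ i ∈ U, ε ≤ dist (z i) (z j)}
  have hclosure : closure B ⊆ {z | ∃ i ∈ U, ε / 2 ≤ dist (z i) (z j)} := by
    intro z hz
    obtain ⟨w, ⟨i, hiU, hi⟩, hzw⟩ := Metric.mem_closure_iff.1 hz (ε / 4) (by positivity)
    refine ⟨i, hiU, ?_⟩
    have hi_near := dist_lp_apply_le z w i
    have hj_near := dist_lp_apply_le z w j
    rw [dist_comm (z i)] at hi_near
    linarith [dist_triangle4 (w i) (z i) (z j) (w j)]
  have hνB : ν (closure B) < c := ((measure_mono hclosure).trans hνU).trans_lt hc'c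
  refine ⟨U, hU, (hG.eventually_measure_lt_of_isClosed isClosed_closure hνB).mono fun n hn => ?_⟩
  refine (measure_mono fun ω hω => ?_).trans_lt hn
  exact subset_closure (s := B) hω

end TightLaws

theorem ofReal_integral_sq {α : Type*} [MeasurableSpace α] {μ : Measure α} {f : α → ℝ}
    (hf : MemLp f 2 μ) : ENNReal.ofReal (∫ x, f x ^ 2 ∂μ) = eLpNorm f 2 μ ^ 2 := by
  have hpow := eLpNorm_nnreal_pow_eq_lintegral (μ := μ) (f := f) two_ne_zero
  simp only [ENNReal.coe_ofNat, NNReal.coe_ofNat, ENNReal.rpow_ofNat] at hpow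
  rw [hpow, ofReal_integral_eq_lintegral_ofReal hf.integrable_sq
    (ae_of_all _ fun x => sq_nonneg _)]
  refine lintegral_congr fun x => ?_
  rw [Real.enorm_eq_ofReal_abs, ← ENNReal.ofReal_pow (abs_nonneg _), sq_abs]

namespace IsBrownianBridgeLaw

variable {𝒳 : Type*} [MeasurableSpace 𝒳] {P : Measure 𝒳} {F : Set (𝒳 → ℝ)}
  {ν : Measure (EllInfty F)}

theorem memLp_two_apply (hν : IsBrownianBridgeLaw P F ν) (f : F) :
    MemLp (fun z : EllInfty F => z f) 2 ν :=
  (hν.gaussian.hasGaussianLaw_eval f).memLp_two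

variable [IsProbabilityMeasure P]

theorem covariance_apply (hν : IsBrownianBridgeLaw P F ν) {f g : F} (hf : MemLp f.1 2 P)
    (hg : MemLp g.1 2 P) :
    cov[fun z : EllInfty F => z f, fun z : EllInfty F => z g; ν] = cov[f.1, g.1; P] := by
  rw [hν.covariance_eq, covariance_eq_sub hf hg]
  rfl

theorem variance_apply (hν : IsBrownianBridgeLaw P F ν) {f : F} (hf : MemLp f.1 2 P) :
    Var[fun z : EllInfty F => z f; ν] = Var[f.1; P] := by
  rw [← covariance_self (hν.memLp_two_apply f).aemeasurable, hν.covariance_apply hf hf,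
    covariance_self hf.aemeasurable]

theorem variance_sub_apply (hν : IsBrownianBridgeLaw P F ν) {f g : F} (hf : MemLp f.1 2 P)
    (hg : MemLp g.1 2 P) :
    Var[fun z : EllInfty F => z f - z g; ν] = Var[f.1 - g.1; P] := by
  have := hν.isProbabilityMeasure
  rw [variance_fun_sub (hν.memLp_two_apply f) (hν.memLp_two_apply g), variance_sub hf hg,
    hν.variance_apply hf, hν.variance_apply hg, hν.covariance_apply hf hg]

theorem eLpNorm_sub_apply_le (hν : IsBrownianBridgeLaw P F ν) {f g : F} (hf : MemLp f.1 2 P)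
    (hg : MemLp g.1 2 P) :
    eLpNorm (fun z : EllInfty F => z f - z g) 2 ν ≤ eLpNorm (f.1 - g.1) 2 P := by
  have := hν.isProbabilityMeasure
  have hincr : MemLp (fun z : EllInfty F => z f - z g) 2 ν :=
    (hν.memLp_two_apply f).sub (hν.memLp_two_apply g)
  have hmean : ∫ z : EllInfty F, (z f - z g) ∂ν = 0 := by
    rw [integral_sub ((hν.memLp_two_apply f).integrable one_le_two)
      ((hν.memLp_two_apply g).integrable one_le_two), hν.mean_zero, hν.mean_zero, sub_zero]
  rw [← ENNReal.pow_le_pow_left_iff two_ne_zero, ← ofReal_integral_sq hincr,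
    ← ofReal_integral_sq (hf.sub hg), ← variance_of_integral_eq_zero hincr.aemeasurable hmean,
    hν.variance_sub_apply hf hg]
  exact ENNReal.ofReal_le_ofReal (variance_le_expectation_sq (hf.sub hg).aestronglyMeasurable)

theorem tendstoInMeasure_apply (hν : IsBrownianBridgeLaw P F ν) (hF : ∀ f ∈ F, MemLp f 2 P)
    (g : F) : TendstoInMeasure ν (fun (f : F) (z : EllInfty F) => z f)
      (comap (fun f : F => eLpNorm (f.1 - g.1) 2 P) (𝓝 0)) (fun z => z g) :=
  tendstoInMeasure_of_tendsto_eLpNorm two_ne_zero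
    (fun f => (hν.memLp_two_apply f).aestronglyMeasurable)
    (hν.memLp_two_apply g).aestronglyMeasurable
    (tendsto_of_tendsto_of_tendsto_of_le_of_le tendsto_const_nhds tendsto_comap
      (fun _ => zero_le) fun f => hν.eLpNorm_sub_apply_le (hF f f.2) (hF g g.2))

theorem map_apply_eq_gaussianReal (hν : IsBrownianBridgeLaw P F ν) {f : F}
    (hf : MemLp f.1 2 P) :
    ν.map (fun z : EllInfty F => z f) = gaussianReal 0 Var[f.1; P].toNNReal := by
  rw [(hν.gaussian.hasGaussianLaw_eval f).map_eq_gaussianReal, hν.mean_zero, hν.variance_apply hf]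

end IsBrownianBridgeLaw

theorem toEllInfty_apply {𝒳 : Type*} {F : Set (𝒳 → ℝ)} {z : F → ℝ} (hz : Memℓp z ∞) (f : F) :
    toEllInfty F z f = z f := by
  rw [toEllInfty, dif_pos hz]

theorem EllInfty.continuous_apply {𝒳 : Type*} {F : Set (𝒳 → ℝ)} (f : F) :
    Continuous fun z : EllInfty F => z f :=
  (lp.evalCLM ℝ (fun _ : F => ℝ) ∞ f).continuous

namespace IsDonsker

variable {Ω 𝒳 : Type*} [MeasurableSpace Ω] [MeasurableSpace 𝒳] {μ : Measure Ω} {P : Measure 𝒳}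
  {X : ℕ → Ω → 𝒳} {F : Set (𝒳 → ℝ)} {ν : Measure (EllInfty F)} {g : 𝒳 → ℝ}

theorem weaklyConverges_empiricalProcess (hF : IsDonsker μ P X F ν) (hg : g ∈ F) :
    WeaklyConverges μ (fun n ω => empiricalProcess P X n ω g)
      (ν.map fun z : EllInfty F => z ⟨g, hg⟩) :=
  (hF.weaklyConverges.map (EllInfty.continuous_apply ⟨g, hg⟩)).congr_ae fun n =>
    (hF.bounded n).mono fun _ hω => toEllInfty_apply hω _

variable [IsFiniteMeasure μ] [IsProbabilityMeasure P]

theorem exists_eventually_measure_exists_le_dist_lt (hF : IsDonsker μ P X F ν) (hg : g ∈ F) {ε : ℝ}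
    (hε : 0 < ε) {c : ℝ≥0∞} (hc : 0 < c) :
    ∃ δ : ℝ≥0∞, 0 < δ ∧ ∀ᶠ n in atTop, μ {ω | ∃ f ∈ F, eLpNorm (f - g) 2 P < δ ∧
      ε ≤ dist (empiricalProcess P X n ω f) (empiricalProcess P X n ω g)} < c := by
  have := hF.brownianBridge.isProbabilityMeasure
  obtain ⟨U, hU, hGU⟩ := hF.weaklyConverges.eventually_measure_exists_le_dist_apply_lt
    hF.brownianBridge.tight (hF.brownianBridge.tendstoInMeasure_apply hF.memLp_two ⟨g, hg⟩) hε hc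
  obtain ⟨δ, hδ, hδU⟩ := (ENNReal.nhds_zero_basis.comap _).mem_iff.1 hU
  refine ⟨δ, hδ, hGU.mono fun n hn => (measure_mono_ae ?_).trans_lt hn⟩
  filter_upwards [hF.bounded n] with ω hω ⟨f, hf, hfg, hincr⟩
  refine ⟨⟨f, hf⟩, hδU hfg, ?_⟩
  rwa [toEllInfty_apply hω, toEllInfty_apply hω]

theorem asympEquivInProb_empiricalProcess (hF : IsDonsker μ P X F ν) (hg : g ∈ F)
    {φ : ℕ → Ω → 𝒳 → ℝ} (hφ_mem : Tendsto (fun n => μ {ω | φ n ω ∉ F}) atTop (𝓝 0))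
    (hφ : ∀ ε : ℝ≥0∞, 0 < ε →
      Tendsto (fun n => μ {ω | ε ≤ eLpNorm (φ n ω - g) 2 P}) atTop (𝓝 0)) :
    AsympEquivInProb μ (fun n ω => empiricalProcess P X n ω (φ n ω))
      (fun n ω => empiricalProcess P X n ω g) := by
  intro ε hε
  rw [ENNReal.tendsto_nhds_zero]
  intro c hc
  have hc₃ : 0 < c / 3 := ENNReal.div_pos hc.ne' ENNReal.ofNat_ne_top
  obtain ⟨δ, hδ, hosc⟩ := hF.exists_eventually_measure_exists_le_dist_lt hg hε hc₃
  filter_upwards [hosc, hφ_mem.eventually_lt_const hc₃, (hφ δ hδ).eventually_lt_const hc₃]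
    with n hosc_n hmem_n hdist_n
  refine (measure_mono fun ω hω => ?_).trans <| (measure_union_le _ _).trans <|
    (add_le_add ((measure_union_le _ _).trans (add_le_add hosc_n.le hmem_n.le)) hdist_n.le).trans
      (ENNReal.add_thirds c).le
  by_cases hmem : φ n ω ∈ F
  · rcases lt_or_ge (eLpNorm (φ n ω - g) 2 P) δ with hlt | hge
    · exact Or.inl (Or.inl ⟨φ n ω, hmem, hlt, hω⟩)
    · exact Or.inr hge
  · exact Or.inl (Or.inr hmem)

end IsDonsker

theorem theorem1_general {Ω 𝒳 : Type*} [MeasurableSpace Ω] [MeasurableSpace 𝒳] {μ : Measure Ω}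
    [IsFiniteMeasure μ] {P : Measure 𝒳} [IsProbabilityMeasure P] {X : ℕ → Ω → 𝒳}
    {F : Set (𝒳 → ℝ)} {ν : Measure (EllInfty F)} (hF : IsDonsker μ P X F ν)
    {θ : ℕ → Ω → ℝ} {θ₀ : ℝ} {φ₀ : 𝒳 → ℝ} (hφ₀ : φ₀ ∈ F) {φ : ℕ → Ω → 𝒳 → ℝ}
    (hφ_mem : Tendsto (fun n => μ {ω | φ n ω ∉ F}) atTop (𝓝 0))
    (hφ_cons : ∀ ε : ℝ≥0∞, 0 < ε →
      Tendsto (fun n => μ {ω | ε ≤ eLpNorm (φ n ω - φ₀) 2 P}) atTop (𝓝 0))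
    (hR : IsLittleOPRootN μ fun n ω =>
      θ n ω - θ₀ - (empiricalMean X n ω (φ n ω) - ∫ x, φ n ω x ∂P)) :
    IsLittleOPRootN μ (fun n ω => θ n ω - θ₀ - (empiricalMean X n ω φ₀ - ∫ x, φ₀ x ∂P)) ∧
    WeaklyConverges μ (fun n ω => √(n : ℝ) * (θ n ω - θ₀))
      (ν.map fun z : EllInfty F => z ⟨φ₀, hφ₀⟩) ∧
    ν.map (fun z : EllInfty F => z ⟨φ₀, hφ₀⟩) = gaussianReal 0 Var[φ₀; P].toNNReal := by
  have := hF.brownianBridge.isProbabilityMeasure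
  have hlinear : AsympEquivInProb μ (fun n ω => √(n : ℝ) * (θ n ω - θ₀))
      (fun n ω => empiricalProcess P X n ω φ₀) :=
    (isLittleOPRootN_sub_iff.1 hR).trans
      (hF.asympEquivInProb_empiricalProcess hφ₀ hφ_mem hφ_cons)
  exact ⟨isLittleOPRootN_sub_iff.2 hlinear,
    (hF.weaklyConverges_empiricalProcess hφ₀).of_asympEquivInProb hlinear,
    hF.brownianBridge.map_apply_eq_gaussianReal (hF.memLp_two φ₀ hφ₀)⟩

theorem theorem1 {Ω 𝒳 H : Type*} [MeasurableSpace Ω] [MeasurableSpace 𝒳]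
    -- an IID sample `X 0, X 1, …` from `P₀`
    (μ : Measure Ω) [IsProbabilityMeasure μ]
    (P₀ : Measure 𝒳) [IsProbabilityMeasure P₀]
    (X : ℕ → Ω → 𝒳) (hX_meas : ∀ i, Measurable (X i)) (hX_indep : iIndepFun X μ)
    (hX_law : ∀ i, μ.map (X i) = P₀)
    -- the functional, the nuisance parameter and its estimator
    (T : H → Measure 𝒳 → ℝ) (η₀ : H) (η : ℕ → Ω → H)
    -- the influence function and its estimator
    (φ₀ : 𝒳 → ℝ) (hφ₀_mean : ∫ x, φ₀ x ∂P₀ = 0) (hφ₀_sq : MemLp φ₀ 2 P₀)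
    (φ : ℕ → Ω → 𝒳 → ℝ)
    -- (A1)
    (F : Set (𝒳 → ℝ)) (hφ₀_mem : φ₀ ∈ F)
    (hφ_mem : Tendsto (fun n => μ {ω | φ n ω ∉ F}) atTop (𝓝 0))
    (ν : Measure (EllInfty F)) (hF : IsDonsker μ P₀ X F ν)
    -- (A2)
    (hφ_cons : ∀ ε : ℝ≥0∞, 0 < ε →
      Tendsto (fun n => μ {ω | ε ≤ eLpNorm (φ n ω - φ₀) 2 P₀}) atTop (𝓝 0))
    -- (A3)
    (hR : IsLittleOPRootN μ (fun n ω =>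
      T (η n ω) (empiricalMeasure X n ω) - T η₀ P₀
        - (empiricalMean X n ω (φ n ω) - ∫ x, φ n ω x ∂P₀))) :
    -- asymptotic linearity
    IsLittleOPRootN μ (fun n ω =>
      T (η n ω) (empiricalMeasure X n ω) - (T η₀ P₀ + empiricalMean X n ω φ₀)) ∧
    -- convergence in distribution to `𝔾₀ φ₀`
    WeaklyConverges μ
      (fun n ω => √(n : ℝ) * (T (η n ω) (empiricalMeasure X n ω) - T η₀ P₀))
      (ν.map (fun z : EllInfty F => z ⟨φ₀, hφ₀_mem⟩)) ∧
    -- `𝔾₀ φ₀` is `N(0, P₀ φ₀²)`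
    ν.map (fun z : EllInfty F => z ⟨φ₀, hφ₀_mem⟩) =
      gaussianReal 0 (∫ x, φ₀ x ^ 2 ∂P₀).toNNReal := by
  simpa only [sub_sub, hφ₀_mean, sub_zero,
    variance_of_integral_eq_zero hφ₀_sq.aemeasurable hφ₀_mean]
    using theorem1_general hF hφ₀_mem hφ_mem hφ_cons hR
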